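/- Let $G$ be a locally compact (Hausdorff) group with a left Haar measure $dx$, let $1<p<\infty$ and $\frac1p+\frac1q=1$. Let $A_p(G)$ be the linear subspace of $C_0(G)$ consisting of all functions of the form $u(x)=\sum_{i=1}^{\infty}(g_i*f_i^{\vee})(x)$, where $f_i\in L^p(G)$, $g_i\in L^q(G)$, $\sum_{i=1}^\infty\|f_i\|_p\|g_i\|_q<\infty$, $f^{\vee}(x)=f(x^{-1})$ and $(g*h)(x)=\int_G g(y)h(y^{-1}x)\,dy$, with the norm $$\|u\|_{A_p(G)}=\inf\Big\{\sum_{i=1}^{\infty}\|f_i\|_p\|g_i\|_q : u=\sum_{i=1}^{\infty}g_i*f_i^{\vee}\Big\},$$ where the infimum is over all such representations of $u$. Let $B_p(G)$ be the space of all bounded continuous functions $u:G\to\mathbb C$ such that $uv\in A_p(G)$ for all $v\in A_p(G)$, and for $u\in B_p(G)$ let $\Gamma_u:A_p(G)\to A_p(G)$ be the operator $\Gamma_u(v)=uv$ (pointwise product). If for some $u\neq 0$ in $B_p(G)$ the operator $\Gamma_u$ is weakly compact (that is, the image of the closed unit ball of $A_p(G)$ is relatively compact in the weak topology of $A_p(G)$)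 or compact, then $G$ is discrete. -/

import Mathlib

open MeasureTheory
open scoped ENNReal BoundedContinuousFunction ZeroAtInfty

noncomputable section

namespace HerzAlgebra

/-- The check `f^∨ (x) = f (x⁻¹)` of a function on a group. -/
def check {G : Type*} [Group G] (f : G → ℂ) : G → ℂ := fun x => f x⁻¹

/-- Convolution `(g * h) (x) = ∫ g(y) h(y⁻¹ x) dy` with respect to a measure `μ`. -/
def conv {G : Type*} [Group G] [MeasurableSpace G] (μ : Measure G) (g h : G → ℂ) : G → ℂ :=
  fun x => ∫ y, g y * h (y⁻¹ * x) ∂μ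

/-- The `L^p` norm as a real number (used for functions in `L^p` only). -/
def lpn {G : Type*} [MeasurableSpace G] (p : ℝ≥0∞) (μ : Measure G) (f : G → ℂ) : ℝ :=
  (eLpNorm f p μ).toReal

/-- `(f, g)` represents `u`: `f i ∈ L^p`, `g i ∈ L^q`, `∑ ‖f i‖_p ‖g i‖_q < ∞` and
`u(x) = ∑ (g i * (f i)^∨)(x)` for every `x`. -/
structure IsRep {G : Type*} [Group G] [MeasurableSpace G] (μ : Measure G) (p q : ℝ≥0∞)
    (f g : ℕ → G → ℂ) (u : G → ℂ) : Prop where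
  memLp_left : ∀ i, MemLp (f i) p μ
  memLp_right : ∀ i, MemLp (g i) q μ
  summable : Summable fun i => lpn p μ (f i) * lpn q μ (g i)
  hasSum : ∀ x, HasSum (fun i => conv μ (g i) (check (f i)) x) (u x)

/-- The cost `∑ ‖f i‖_p ‖g i‖_q` of a representation. -/
def cost {G : Type*} [MeasurableSpace G] (μ : Measure G) (p q : ℝ≥0∞)
    (f g : ℕ → G → ℂ) : ℝ :=
  ∑' i, lpn p μ (f i) * lpn q μ (g i)

/-- The set of costs of all representations of `u`. -/
def costs {G : Type*} [Group G] [MeasurableSpace G] (μ : Measure G) (p q : ℝ≥0∞)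
    (u : G → ℂ) : Set ℝ :=
  {s | ∃ f g : ℕ → G → ℂ, IsRep μ p q f g u ∧ s = cost μ p q f g}

/-- `‖u‖_{A_p(G)}`: the infimum of the costs of the representations of `u`. -/
def herzNorm {G : Type*} [Group G] [MeasurableSpace G] (μ : Measure G) (p q : ℝ≥0∞)
    (u : G → ℂ) : ℝ :=
  sInf (costs μ p q u)

theorem cost_nonneg {G : Type*} [MeasurableSpace G] (μ : Measure G) (p q : ℝ≥0∞)
    (f g : ℕ → G → ℂ) : 0 ≤ cost μ p q f g :=
  tsum_nonneg fun _ => mul_nonneg ENNReal.toReal_nonneg ENNReal.toReal_nonneg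

theorem costs_nonneg {G : Type*} [Group G] [MeasurableSpace G] {μ : Measure G} {p q : ℝ≥0∞}
    {u : G → ℂ} {s : ℝ} (hs : s ∈ costs μ p q u) : 0 ≤ s := by
  obtain ⟨f, g, -, rfl⟩ := hs
  exact cost_nonneg μ p q f g

theorem costs_bddBelow {G : Type*} [Group G] [MeasurableSpace G] (μ : Measure G) (p q : ℝ≥0∞)
    (u : G → ℂ) : BddBelow (costs μ p q u) :=
  ⟨0, fun _ hs => costs_nonneg hs⟩

theorem zero_mem_costs {G : Type*} [Group G] [MeasurableSpace G] (μ : Measure G)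
    (p q : ℝ≥0∞) : (0 : ℝ) ∈ costs μ p q (0 : G → ℂ) := by
  refine ⟨fun _ => 0, fun _ => 0, ⟨fun _ => MemLp.zero, fun _ => MemLp.zero, ?_, ?_⟩, ?_⟩
  · simp [lpn]
  · intro x
    simp [conv, hasSum_zero]
  · simp [cost, lpn]

theorem smul_mem_costs {G : Type*} [Group G] [MeasurableSpace G] {μ : Measure G}
    {p q : ℝ≥0∞} {u : G → ℂ} {s : ℝ} (c : ℂ) (hs : s ∈ costs μ p q u) :
    ‖c‖ * s ∈ costs μ p q (c • u) := by
  obtain ⟨f, g, h, rfl⟩ := hs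
  have key : ∀ i, lpn p μ (f i) * lpn q μ (c • g i) =
      ‖c‖ * (lpn p μ (f i) * lpn q μ (g i)) := by
    intro i
    simp only [lpn, eLpNorm_const_smul, ENNReal.toReal_mul, toReal_enorm]
    ring
  refine ⟨f, fun i => c • g i, ⟨h.memLp_left, fun i => (h.memLp_right i).const_smul c, ?_, ?_⟩,
    ?_⟩
  · simp only [key]
    exact h.summable.mul_left _
  · intro x
    have hc : ∀ i, conv μ (c • g i) (check (f i)) x = c * conv μ (g i) (check (f i)) x := by
      intro i
      simp only [conv, Pi.smul_apply, smul_eq_mul, mul_assoc]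
      exact integral_const_mul _ _
    simp only [hc]
    exact (h.hasSum x).mul_left c
  · simp only [cost, key]
    exact tsum_mul_left.symm

theorem add_mem_costs {G : Type*} [Group G] [MeasurableSpace G] {μ : Measure G}
    {p q : ℝ≥0∞} {u v : G → ℂ} {s t : ℝ} (hs : s ∈ costs μ p q u) (ht : t ∈ costs μ p q v) :
    s + t ∈ costs μ p q (u + v) := by
  obtain ⟨f, g, h, rfl⟩ := hs
  obtain ⟨f', g', h', rfl⟩ := ht
  let e : ℕ ≃ ℕ ⊕ ℕ := Equiv.natSumNatEquivNat.symm
  let F : ℕ ⊕ ℕ → G → ℂ := Sum.elim f f'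
  let K : ℕ ⊕ ℕ → G → ℂ := Sum.elim g g'
  have hsum : HasSum (fun j => lpn p μ (F j) * lpn q μ (K j))
      (cost μ p q f g + cost μ p q f' g') :=
    HasSum.sum h.summable.hasSum h'.summable.hasSum
  have hsum' := e.hasSum_iff.mpr hsum
  refine ⟨fun i => F (e i), fun i => K (e i), ⟨fun i => ?_, fun i => ?_, hsum'.summable, ?_⟩,
    hsum'.tsum_eq.symm⟩
  · show MemLp (F (e i)) p μ
    rcases e i with j | j
    exacts [h.memLp_left j, h'.memLp_left j]
  · show MemLp (K (e i)) q μ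
    rcases e i with j | j
    exacts [h.memLp_right j, h'.memLp_right j]
  · intro x
    have hx : HasSum (fun j => conv μ (K j) (check (F j)) x) (u x + v x) :=
      HasSum.sum (h.hasSum x) (h'.hasSum x)
    exact e.hasSum_iff.mpr hx

/-- Hölder's inequality for `(g * f^∨)(x)`. -/
theorem norm_conv_check_le {G : Type*} [Group G] [TopologicalSpace G] [IsTopologicalGroup G]
    [MeasurableSpace G] [BorelSpace G] {μ : Measure G} [μ.IsMulLeftInvariant] {p q : ℝ≥0∞}
    [p.HolderConjugate q] {f g : G → ℂ} (hf : MemLp f p μ) (hg : MemLp g q μ) (x : G) :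
    ‖conv μ g (check f) x‖ ≤ lpn p μ f * lpn q μ g := by
  have hmp := measurePreserving_mul_left μ x⁻¹
  have hf' : MemLp (fun y => f (x⁻¹ * y)) p μ := hf.comp_measurePreserving hmp
  have hn : eLpNorm (fun y => f (x⁻¹ * y)) p μ = eLpNorm f p μ :=
    eLpNorm_comp_measurePreserving hf.1 hmp
  have h1 : conv μ g (check f) x = ∫ y, ((fun y => f (x⁻¹ * y)) • g) y ∂μ := by
    simp only [conv, check, Pi.smul_apply', smul_eq_mul, mul_inv_rev, inv_inv, mul_comm (g _)]
  have h2 : eLpNorm ((fun y => f (x⁻¹ * y)) • g) 1 μ ≤ eLpNorm f p μ * eLpNorm g q μ :=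
    hn ▸ eLpNorm_smul_le_mul_eLpNorm hg.1 hf'.1
  rw [h1, lpn, lpn, ← ENNReal.toReal_mul]
  refine (norm_integral_le_lintegral_norm _).trans ?_
  refine ENNReal.toReal_mono (ENNReal.mul_ne_top hf.2.ne hg.2.ne) ?_
  rw [eLpNorm_one_eq_lintegral_enorm] at h2
  simpa only [ofReal_norm] using h2

theorem norm_apply_le_of_mem_costs {G : Type*} [Group G] [TopologicalSpace G]
    [IsTopologicalGroup G] [MeasurableSpace G] [BorelSpace G] {μ : Measure G}
    [μ.IsMulLeftInvariant] {p q : ℝ≥0∞} [p.HolderConjugate q] {u : G → ℂ} {s : ℝ}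
    (hs : s ∈ costs μ p q u) (x : G) : ‖u x‖ ≤ s := by
  obtain ⟨f, g, h, rfl⟩ := hs
  rw [← (h.hasSum x).tsum_eq]
  exact tsum_of_norm_bounded h.summable.hasSum
    fun i => norm_conv_check_le (h.memLp_left i) (h.memLp_right i) x

/-- The linear subspace of `C₀(G)` of all functions `u = ∑ g i * (f i)^∨` with
`∑ ‖f i‖_p ‖g i‖_q < ∞`. -/
def herzSubmodule {G : Type*} [Group G] [TopologicalSpace G] [MeasurableSpace G]
    (μ : Measure G) (p q : ℝ≥0∞) : Submodule ℂ C₀(G, ℂ) where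
  carrier := {u | ∃ f g : ℕ → G → ℂ, IsRep μ p q f g u}
  zero_mem' := by
    obtain ⟨f, g, h, -⟩ := zero_mem_costs (G := G) μ p q
    exact ⟨f, g, h⟩
  add_mem' := by
    rintro u v ⟨f, g, h⟩ ⟨f', g', h'⟩
    obtain ⟨F, K, H, -⟩ := add_mem_costs ⟨f, g, h, rfl⟩ ⟨f', g', h', rfl⟩
    exact ⟨F, K, H⟩
  smul_mem' := by
    rintro c u ⟨f, g, h⟩
    obtain ⟨F, K, H, -⟩ := smul_mem_costs c ⟨f, g, h, rfl⟩
    exact ⟨F, K, H⟩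

/-- The Herz algebra `A_p(G)`, for conjugate exponents `p` and `q`. This is a type of its own, not
an abbreviation of the subspace of `C₀(G)`, because it carries the norm `herzNorm` and not
the supremum norm. -/
def Ap {G : Type*} [Group G] [TopologicalSpace G] [MeasurableSpace G]
    (μ : Measure G) (p q : ℝ≥0∞) : Type _ := herzSubmodule μ p q

section Instances

variable {G : Type*} [Group G] [TopologicalSpace G] [MeasurableSpace G]
  (μ : Measure G) (p q : ℝ≥0∞)

instance : AddCommGroup (Ap μ p q) := inferInstanceAs (AddCommGroup (herzSubmodule μ p q))

instance : Module ℂ (Ap μ p q) := inferInstanceAs (Module ℂ (herzSubmodule μ p q))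

/-- An element of `A_p(G)` as a function in `C₀(G)`. -/
def Ap.toC0 : Ap μ p q →ₗ[ℂ] C₀(G, ℂ) := (herzSubmodule μ p q).subtype

instance : Norm (Ap μ p q) := ⟨fun u => herzNorm μ p q (Ap.toC0 μ p q u)⟩

end Instances

theorem Ap.norm_def {G : Type*} [Group G] [TopologicalSpace G] [MeasurableSpace G]
    {μ : Measure G} {p q : ℝ≥0∞} (u : Ap μ p q) : ‖u‖ = herzNorm μ p q (Ap.toC0 μ p q u) := rfl

theorem Ap.toC0_injective {G : Type*} [Group G] [TopologicalSpace G] [MeasurableSpace G]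
    {μ : Measure G} {p q : ℝ≥0∞} : Function.Injective (Ap.toC0 μ p q) :=
  Subtype.val_injective

theorem Ap.toC0_mem {G : Type*} [Group G] [TopologicalSpace G] [MeasurableSpace G]
    {μ : Measure G} {p q : ℝ≥0∞} (u : Ap μ p q) : Ap.toC0 μ p q u ∈ herzSubmodule μ p q :=
  u.2

theorem Ap.costs_nonempty {G : Type*} [Group G] [TopologicalSpace G] [MeasurableSpace G]
    {μ : Measure G} {p q : ℝ≥0∞} (u : Ap μ p q) : (costs μ p q (Ap.toC0 μ p q u)).Nonempty := by
  obtain ⟨f, g, h⟩ := Ap.toC0_mem u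
  exact ⟨_, f, g, h, rfl⟩

theorem Ap.norm_apply_le {G : Type*} [Group G] [TopologicalSpace G]
    [IsTopologicalGroup G] [MeasurableSpace G] [BorelSpace G] {μ : Measure G}
    [μ.IsMulLeftInvariant] {p q : ℝ≥0∞} [p.HolderConjugate q] (u : Ap μ p q) (x : G) :
    ‖Ap.toC0 μ p q u x‖ ≤ ‖u‖ :=
  le_csInf (Ap.costs_nonempty u) fun _ hs => norm_apply_le_of_mem_costs hs x

theorem Ap.norm_smul_le' {G : Type*} [Group G] [TopologicalSpace G] [MeasurableSpace G]
    {μ : Measure G} {p q : ℝ≥0∞} (c : ℂ) (hc : c ≠ 0) (u : Ap μ p q) :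
    ‖c • u‖ ≤ ‖c‖ * ‖u‖ := by
  have hc' : 0 < ‖c‖ := norm_pos_iff.mpr hc
  rw [← div_le_iff₀' hc', Ap.norm_def u]
  refine le_csInf (Ap.costs_nonempty u) fun s hs => ?_
  rw [div_le_iff₀' hc', Ap.norm_def]
  refine csInf_le (costs_bddBelow _ _ _ _) ?_
  rw [map_smul]
  exact smul_mem_costs c hs

theorem Ap.core {G : Type*} [Group G] [TopologicalSpace G] [IsTopologicalGroup G]
    [MeasurableSpace G] [BorelSpace G] (μ : Measure G) [μ.IsMulLeftInvariant] (p q : ℝ≥0∞)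
    [p.HolderConjugate q] : NormedSpace.Core ℂ (Ap μ p q) where
  norm_nonneg u := (norm_nonneg _).trans (Ap.norm_apply_le u 1)
  norm_smul c u := by
    by_cases hc : c = 0
    · subst hc
      have h0 : ‖(0 : Ap μ p q)‖ = 0 := by
        refine le_antisymm ?_ ((norm_nonneg _).trans (Ap.norm_apply_le (0 : Ap μ p q) 1))
        rw [Ap.norm_def, map_zero]
        exact csInf_le (costs_bddBelow _ _ _ _) (zero_mem_costs μ p q)
      rw [zero_smul, h0, norm_zero, zero_mul]
    · refine le_antisymm (Ap.norm_smul_le' c hc u) ?_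
      have h := Ap.norm_smul_le' c⁻¹ (inv_ne_zero hc) (c • u)
      rw [inv_smul_smul₀ hc, norm_inv] at h
      rwa [← le_inv_mul_iff₀ (norm_pos_iff.mpr hc)]
  norm_triangle u v := by
    rw [Ap.norm_def u, Ap.norm_def v]
    refine le_of_forall_pos_le_add fun ε hε => ?_
    obtain ⟨s, hs, hs'⟩ := exists_lt_of_csInf_lt (Ap.costs_nonempty u)
      (lt_add_of_pos_right (herzNorm μ p q (Ap.toC0 μ p q u)) (half_pos hε))
    obtain ⟨t, ht, ht'⟩ := exists_lt_of_csInf_lt (Ap.costs_nonempty v)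
      (lt_add_of_pos_right (herzNorm μ p q (Ap.toC0 μ p q v)) (half_pos hε))
    have : ‖u + v‖ ≤ s + t := by
      rw [Ap.norm_def]
      refine csInf_le (costs_bddBelow _ _ _ _) ?_
      rw [map_add]
      exact add_mem_costs hs ht
    linarith
  norm_eq_zero_iff u := by
    constructor
    · intro h
      apply Ap.toC0_injective
      ext x
      have hx := Ap.norm_apply_le u x
      rw [h] at hx
      rw [map_zero]
      simpa using hx
    · rintro rfl
      refine le_antisymm ?_ ((norm_nonneg _).trans (Ap.norm_apply_le (0 : Ap μ p q) 1))
      rw [Ap.norm_def, map_zero]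
      exact csInf_le (costs_bddBelow _ _ _ _) (zero_mem_costs μ p q)

section Normed

variable {G : Type*} [Group G] [TopologicalSpace G] [IsTopologicalGroup G]
  [MeasurableSpace G] [BorelSpace G] (μ : Measure G) [μ.IsMulLeftInvariant] (p q : ℝ≥0∞)
  [p.HolderConjugate q]

instance : NormedAddCommGroup (Ap μ p q) := NormedAddCommGroup.ofCore (Ap.core μ p q)

instance : NormedSpace ℂ (Ap μ p q) := NormedSpace.ofCore (Ap.core μ p q)

end Normed

/-- The pointwise product of a bounded continuous function and a function in `C₀(G)`. -/
def bddMul {G : Type*} [TopologicalSpace G] (u : G →ᵇ ℂ) (v : C₀(G, ℂ)) : C₀(G, ℂ) where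
  toFun x := u x * v x
  continuous_toFun := u.continuous.mul v.continuous
  zero_at_infty' := by
    refine squeeze_zero_norm (a := fun x => ‖u‖ * ‖v x‖) (fun x => ?_) ?_
    · rw [norm_mul]
      exact mul_le_mul_of_nonneg_right (u.norm_coe_le_norm x) (norm_nonneg _)
    · have h : Filter.Tendsto v (Filter.cocompact G) (nhds 0) := v.zero_at_infty'
      simpa using h.norm.const_mul ‖u‖

/-- The space `B_p(G)` of pointwise multipliers of `A_p(G)`: the bounded continuous functions `u`
with `u v ∈ A_p(G)` for all `v ∈ A_p(G)`. -/
def Bp {G : Type*} [Group G] [TopologicalSpace G] [MeasurableSpace G]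
    (μ : Measure G) (p q : ℝ≥0∞) : Submodule ℂ (G →ᵇ ℂ) where
  carrier := {u | ∀ v ∈ herzSubmodule μ p q, bddMul u v ∈ herzSubmodule μ p q}
  zero_mem' := by
    intro v _
    have h : bddMul (0 : G →ᵇ ℂ) v = 0 := by ext x; simp [bddMul]
    rw [h]
    exact zero_mem _
  add_mem' := by
    intro a b ha hb v hv
    have h : bddMul (a + b) v = bddMul a v + bddMul b v := by ext x; simp [bddMul, add_mul]
    rw [h]
    exact add_mem (ha v hv) (hb v hv)
  smul_mem' := by
    intro c a ha v hv
    have h : bddMul (c • a) v = c • bddMul a v := by ext x; simp [bddMul, mul_assoc]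
    rw [h]
    exact Submodule.smul_mem _ c (ha v hv)

/-- A function in `C₀(G)` that lies in the Herz subspace, as an element of `A_p(G)`. -/
def Ap.mk {G : Type*} [Group G] [TopologicalSpace G] [MeasurableSpace G]
    {μ : Measure G} {p q : ℝ≥0∞} (u : C₀(G, ℂ)) (hu : u ∈ herzSubmodule μ p q) : Ap μ p q :=
  ⟨u, hu⟩

theorem Ap.toC0_mk {G : Type*} [Group G] [TopologicalSpace G] [MeasurableSpace G]
    {μ : Measure G} {p q : ℝ≥0∞} (u : C₀(G, ℂ)) (hu : u ∈ herzSubmodule μ p q) :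
    Ap.toC0 μ p q (Ap.mk u hu) = u := rfl

/-- The multiplication operator `Γ_u : A_p(G) → A_p(G)`, `v ↦ u v`, for `u ∈ B_p(G)`. -/
def Gam {G : Type*} [Group G] [TopologicalSpace G] [MeasurableSpace G]
    {μ : Measure G} {p q : ℝ≥0∞} (u : Bp μ p q) : Ap μ p q →ₗ[ℂ] Ap μ p q where
  toFun v := Ap.mk (bddMul u (Ap.toC0 μ p q v)) (u.2 _ (Ap.toC0_mem v))
  map_add' v w := by
    apply Ap.toC0_injective
    ext x
    simp only [map_add, Ap.toC0_mk]
    exact mul_add _ _ _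
  map_smul' c v := by
    apply Ap.toC0_injective
    ext x
    simp only [map_smul, Ap.toC0_mk, RingHom.id_apply]
    exact mul_left_comm _ _ _

theorem Gam_apply {G : Type*} [Group G] [TopologicalSpace G] [MeasurableSpace G]
    {μ : Measure G} {p q : ℝ≥0∞} (u : Bp μ p q) (v : Ap μ p q) (x : G) :
    Ap.toC0 μ p q (Gam u v) x = (u : G →ᵇ ℂ) x * Ap.toC0 μ p q v x := rfl

/-- A linear operator between normed spaces is weakly compact if the image of the closed unit ball
is relatively compact in the weak topology of the target. -/
def IsWeaklyCompactOperator {E F : Type*} [NormedAddCommGroup E] [NormedSpace ℂ E]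
    [NormedAddCommGroup F] [NormedSpace ℂ F] (T : E →ₗ[ℂ] F) : Prop :=
  IsCompact (closure (toWeakSpace ℂ F '' (T '' Metric.closedBall (0 : E) 1)))

end HerzAlgebra

end

namespace HerzAlgebra

open Filter Topology Function
open scoped Pointwise

/-! The unit ball of `A_p(G)` contains functions equal to `1` at a given point `a` and vanishing off
any prescribed neighbourhood of `a` (`exists_Ap_bump`). In particular they can be made to vanish at
any finite set of points other than `a`.

By Hölder, point evaluations are bounded functionals on `A_p(G)`, so both the norm and the weak
topology refine pointwise convergence. Either compactness hypothesis therefore puts the products `u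
v`, for `v` in some ball, inside a pointwise compact set of continuous functions. If `u a ≠ 0`, the
finite intersection property yields in that set a function nonzero at `a` and zero elsewhere
(`discreteTopology_of_isCompact_pointwise`). Being continuous, it makes `{a}` open, and translation
makes `G` discrete. -/

/-! ### Convolutions of compactly supported functions -/

/-- The convolution `g * f^∨` of compactly supported continuous functions is continuous. -/
theorem continuous_conv_check {G : Type*} [Group G] [TopologicalSpace G] [IsTopologicalGroup G]
    [MeasurableSpace G] [BorelSpace G] (μ : Measure G) [IsFiniteMeasureOnCompacts μ]
    {f g : G → ℂ} (hf : Continuous f) (hg : Continuous g) (hgc : HasCompactSupport g) :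
    Continuous (conv μ g (check f)) := by
  rw [← continuousOn_univ]
  refine continuousOn_integral_of_compact_support (k := tsupport g) hgc ?_ ?_
  · refine Continuous.continuousOn ?_
    change Continuous fun z : G × G => g z.2 * f (z.2⁻¹ * z.1)⁻¹
    fun_prop
  · intro x y _ hy
    rw [image_eq_zero_of_notMem_tsupport hy, zero_mul]

/-- Off the set `supp g · (supp f)⁻¹` the convolution `g * f^∨` vanishes. -/
theorem conv_check_eq_zero {G : Type*} [Group G] [MeasurableSpace G] (μ : Measure G)
    {f g : G → ℂ} {x : G} (h : ∀ y, g y ≠ 0 → f (x⁻¹ * y) = 0) :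
    conv μ g (check f) x = 0 := by
  rw [conv, ← integral_zero G ℂ (μ := μ)]
  congr 1
  ext y
  by_cases hy : g y = 0
  · simp [hy]
  · simp [check, h y hy]

theorem hasCompactSupport_conv_check {G : Type*} [Group G] [TopologicalSpace G]
    [IsTopologicalGroup G] [T2Space G] [MeasurableSpace G] (μ : Measure G)
    {f g : G → ℂ} (hfc : HasCompactSupport f) (hgc : HasCompactSupport g) :
    HasCompactSupport (conv μ g (check f)) := by
  refine HasCompactSupport.intro
    (IsCompact.mul (s := tsupport g) (t := (tsupport f)⁻¹) hgc hfc.inv) fun x hx => ?_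
  refine conv_check_eq_zero μ fun y hy => ?_
  by_contra hne
  -- The factorisation is `x = y * (x⁻¹ * y)⁻¹`.
  refine hx ⟨y, subset_tsupport _ hy, (x⁻¹ * y)⁻¹, ?_, by simp⟩
  simpa using subset_tsupport _ hne

/-- The convolution `g * f^∨` of compactly supported continuous functions belongs to `A_p(G)`, with
norm at most `‖f‖_p ‖g‖_q`. -/
theorem exists_Ap_eq_conv_check {G : Type*} [Group G] [TopologicalSpace G] [IsTopologicalGroup G]
    [T2Space G] [MeasurableSpace G] [BorelSpace G] (μ : Measure G) [IsFiniteMeasureOnCompacts μ]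
    (p q : ℝ≥0∞) {f g : G → ℂ} (hf : Continuous f) (hfc : HasCompactSupport f)
    (hg : Continuous g) (hgc : HasCompactSupport g) :
    ∃ v : Ap μ p q, (∀ x, Ap.toC0 μ p q v x = conv μ g (check f) x) ∧
      ‖v‖ ≤ lpn p μ f * lpn q μ g := by
  let w : C₀(G, ℂ) := ⟨⟨conv μ g (check f), continuous_conv_check μ hf hg hgc⟩,
    (hasCompactSupport_conv_check μ hfc hgc).is_zero_at_infty⟩
  -- A one-term representation, padded with zeros to a sequence.
  let F : ℕ → G → ℂ := fun i => if i = 0 then f else 0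
  let K : ℕ → G → ℂ := fun i => if i = 0 then g else 0
  have hcost : HasSum (fun i => lpn p μ (F i) * lpn q μ (K i)) (lpn p μ f * lpn q μ g) :=
    hasSum_single 0 fun i hi => by simp [F, hi, lpn]
  have hrep : IsRep μ p q F K w := by
    refine ⟨fun i => ?_, fun i => ?_, hcost.summable, fun x => ?_⟩
    · by_cases hi : i = 0
      · simpa [F, hi] using hf.memLp_of_hasCompactSupport hfc
      · simp [F, hi]
    · by_cases hi : i = 0
      · simpa [K, hi] using hg.memLp_of_hasCompactSupport hgc
      · simp [K, hi]
    · exact hasSum_single 0 fun i hi => by simp [K, hi, conv]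
  refine ⟨Ap.mk w ⟨F, K, hrep⟩, fun x => rfl, ?_⟩
  rw [Ap.norm_def]
  exact csInf_le (costs_bddBelow _ _ _ _) ⟨F, K, hrep, hcost.tsum_eq.symm⟩

/-! ### Bump functions in the unit ball -/

/-- The power `φ^(1/r)` of a nonnegative function `φ` has `L^r` norm `(∫ φ)^(1/r)`. -/
theorem lpn_rpow_inv {G : Type*} [TopologicalSpace G] [MeasurableSpace G]
    [OpensMeasurableSpace G] (μ : Measure G) [IsFiniteMeasureOnCompacts μ] {r : ℝ≥0∞}
    (hr0 : r ≠ 0) (hr : r ≠ ∞) {φ : G → ℝ} (h0 : ∀ x, 0 ≤ φ x)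
    (hc : Continuous fun x => ((φ x ^ r.toReal⁻¹ : ℝ) : ℂ))
    (hs : HasCompactSupport fun x => ((φ x ^ r.toReal⁻¹ : ℝ) : ℂ)) :
    lpn r μ (fun x => ((φ x ^ r.toReal⁻¹ : ℝ) : ℂ)) = (∫ x, φ x ∂μ) ^ r.toReal⁻¹ := by
  have hr' : r.toReal ≠ 0 := (ENNReal.toReal_pos hr0 hr).ne'
  rw [lpn, (hc.memLp_of_hasCompactSupport hs).eLpNorm_eq_integral_rpow_norm hr0 hr]
  have h : ∀ x, ‖((φ x ^ r.toReal⁻¹ : ℝ) : ℂ)‖ ^ r.toReal = φ x := fun x => by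
    rw [Complex.norm_real, Real.norm_of_nonneg (Real.rpow_nonneg (h0 x) _),
      Real.rpow_inv_rpow (h0 x) hr']
  simp only [h]
  exact ENNReal.toReal_ofReal (Real.rpow_nonneg (integral_nonneg h0) _)

/-- For every point `a` and every neighbourhood `a W` of it there is a function in the closed unit
ball of `A_p(G)` with value `1` at `a` that vanishes off `a W`. -/
theorem exists_Ap_bump {G : Type*} [Group G] [TopologicalSpace G] [IsTopologicalGroup G]
    [LocallyCompactSpace G] [T2Space G] [MeasurableSpace G] [BorelSpace G]
    (μ : Measure G) [μ.IsHaarMeasure] (p q : ℝ≥0∞) [p.HolderConjugate q] (hp : 1 < p)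
    (hp' : p < ∞) (a : G) {W : Set G} (hW : W ∈ 𝓝 (1 : G)) :
    ∃ v : Ap μ p q, ‖v‖ ≤ 1 ∧ Ap.toC0 μ p q v a = 1 ∧
      ∀ x, a⁻¹ * x ∉ W → Ap.toC0 μ p q v x = 0 := by
  have hp0 : p ≠ 0 := (zero_lt_one.trans hp).ne'
  have hpq : p⁻¹ + q⁻¹ = 1 := ENNReal.holderConjugate_iff.mp inferInstance
  have hq0 : q ≠ 0 := by
    rintro rfl
    simp at hpq
  have hq : q ≠ ∞ := by
    rintro rfl
    simp only [ENNReal.inv_top, add_zero, ENNReal.inv_eq_one] at hpq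
    exact hp.ne' hpq
  have hpr : 0 < p.toReal⁻¹ := inv_pos.mpr (ENNReal.toReal_pos hp0 hp'.ne)
  have hqr : 0 < q.toReal⁻¹ := inv_pos.mpr (ENNReal.toReal_pos hq0 hq)
  have hsum : p.toReal⁻¹ + q.toReal⁻¹ = 1 := by
    rw [← ENNReal.toReal_inv, ← ENNReal.toReal_inv,
      ← ENNReal.toReal_add (ENNReal.inv_ne_top.mpr hp0) (ENNReal.inv_ne_top.mpr hq0), hpq,
      ENNReal.toReal_one]
  -- Quotients of elements of `V` lie in `W`; this will apply to `a⁻¹ * x = (a⁻¹ * y) * (x⁻¹ *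
  -- y)⁻¹`.
  obtain ⟨V, hV, hVW⟩ := exists_nhds_split_inv hW
  obtain ⟨φ, hφ1, hφc, hφV, hφ⟩ := exists_continuousMap_one_of_isCompact_subset_isOpen
    (isCompact_singleton (x := (1 : G))) isOpen_interior
    (Set.singleton_subset_iff.mpr (mem_interior_iff_mem_nhds.mpr hV))
  replace hφ1 : φ 1 = 1 := hφ1 rfl
  have hφ0 : ∀ x, 0 ≤ φ x := fun x => (hφ x).1
  have hsupp : ∀ x, φ x ≠ 0 → x ∈ V := fun x hx =>
    interior_subset (hφV (subset_tsupport _ hx))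
  have hφc' : HasCompactSupport φ := hφc
  -- With `f = φ^(1/p)` and `g = ψ^(1/q)`, the value of `g * f^∨` at `a` is `∫ ψ^(1/q) ψ^(1/p) = ∫
  -- φ`. This equals the norm bound `‖f‖_p ‖g‖_q`, so dividing by `∫ φ` gives the bump.
  set ψ : G → ℝ := fun y => φ (a⁻¹ * y) with hψ
  have hψcont : Continuous ψ := by fun_prop
  have hψc : HasCompactSupport ψ := hφc'.comp_homeomorph (Homeomorph.mulLeft a⁻¹)
  have hroot_cont : ∀ {r : ℝ} {χ : G → ℝ}, 0 < r → Continuous χ →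
      Continuous fun x => ((χ x ^ r : ℝ) : ℂ) := fun hr hχ =>
    Complex.continuous_ofReal.comp (hχ.rpow_const fun _ => Or.inr hr.le)
  have hroot_supp : ∀ {r : ℝ} {χ : G → ℝ}, 0 < r → HasCompactSupport χ →
      HasCompactSupport fun x => ((χ x ^ r : ℝ) : ℂ) := fun {r} {χ} hr hχ =>
    hχ.comp_left (g := fun t : ℝ => ((t ^ r : ℝ) : ℂ)) (by simp [Real.zero_rpow hr.ne'])
  have hfcont := hroot_cont hpr φ.continuous
  have hfc := hroot_supp hpr hφc'
  have hgcont := hroot_cont hqr hψcont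
  have hgc := hroot_supp hqr hψc
  obtain ⟨w, hw, hwn⟩ := exists_Ap_eq_conv_check μ p q hfcont hfc hgcont hgc
  have hψint : ∫ x, ψ x ∂μ = ∫ x, φ x ∂μ := integral_mul_left_eq_self (fun x => φ x) a⁻¹
  have hIpos : 0 < ∫ x, φ x ∂μ :=
    φ.continuous.integral_pos_of_hasCompactSupport_nonneg_nonzero hφc' hφ0
      (x := 1) (by simp [hφ1])
  rw [lpn_rpow_inv μ hp0 hp'.ne hφ0 hfcont hfc,
    lpn_rpow_inv μ hq0 hq (fun x => hφ0 _) hgcont hgc, hψint, ← Real.rpow_add hIpos, hsum,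
    Real.rpow_one] at hwn
  have hwa : Ap.toC0 μ p q w a = ((∫ x, φ x ∂μ : ℝ) : ℂ) := by
    rw [hw, conv, ← hψint, ← integral_complex_ofReal]
    congr 1
    ext y
    simp only [check, mul_inv_rev, inv_inv]
    rw [← Complex.ofReal_mul]
    change ((ψ y ^ q.toReal⁻¹ * ψ y ^ p.toReal⁻¹ : ℝ) : ℂ) = _
    rw [← Real.rpow_add_of_nonneg (hφ0 _) hqr.le hpr.le, add_comm, hsum, Real.rpow_one]
  refine ⟨((∫ x, φ x ∂μ : ℝ) : ℂ)⁻¹ • w, ?_, ?_, fun x hx => ?_⟩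
  · rw [norm_smul, norm_inv, Complex.norm_real, Real.norm_of_nonneg hIpos.le,
      inv_mul_le_iff₀ hIpos, mul_one]
    exact hwn
  · have : ((∫ x, φ x ∂μ : ℝ) : ℂ) ≠ 0 := by exact_mod_cast hIpos.ne'
    simp [hwa, this]
  · rw [map_smul, ZeroAtInftyContinuousMap.smul_apply, hw, conv_check_eq_zero, smul_zero]
    intro y hy
    by_contra hne
    have h1 : φ (a⁻¹ * y) ≠ 0 := fun h => hy (by simp [hψ, h, Real.zero_rpow hqr.ne'])
    have h2 : φ (x⁻¹ * y) ≠ 0 := fun h => hne (by simp [h, Real.zero_rpow hpr.ne'])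
    refine hx ?_
    have := hVW _ (hsupp _ h1) _ (hsupp _ h2)
    rwa [div_eq_mul_inv, mul_inv_rev, inv_inv, mul_assoc, mul_inv_cancel_left] at this

/-! ### Pointwise compactness forces discreteness -/

/-- Evaluation at a point, as a continuous linear functional on `A_p(G)`. -/
noncomputable def evalCLM {G : Type*} [Group G] [TopologicalSpace G] [IsTopologicalGroup G]
    [MeasurableSpace G] [BorelSpace G] (μ : Measure G) [μ.IsMulLeftInvariant] (p q : ℝ≥0∞)
    [p.HolderConjugate q] (x : G) : Ap μ p q →L[ℂ] ℂ :=
  LinearMap.mkContinuous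
    { toFun := fun v => Ap.toC0 μ p q v x
      map_add' := fun v w => by simp
      map_smul' := fun c v => by simp } 1 fun v => by
    simpa using Ap.norm_apply_le v x

/-- If a set of continuous functions on `G` is compact for pointwise convergence and contains
`u v` for all `v` in some ball of `A_p(G)`, where `u ≠ 0`, then `G` is discrete. -/
theorem discreteTopology_of_isCompact_pointwise {G : Type*} [Group G] [TopologicalSpace G]
    [IsTopologicalGroup G] [LocallyCompactSpace G] [T2Space G] [MeasurableSpace G] [BorelSpace G]
    (μ : Measure G) [μ.IsHaarMeasure] (p q : ℝ≥0∞) [p.HolderConjugate q] (hp : 1 < p)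
    (hp' : p < ∞) {u : G → ℂ} (hu : u ≠ 0) {K : Set (G → ℂ)} (hK : IsCompact K)
    (hKc : ∀ w ∈ K, Continuous w) {r : ℝ} (hr : 0 < r)
    (huK : ∀ v : Ap μ p q, ‖v‖ ≤ r → (fun x => u x * Ap.toC0 μ p q v x) ∈ K) :
    DiscreteTopology G := by
  obtain ⟨a, ha⟩ := Function.ne_iff.mp hu
  let Z : {x : G // x ≠ a} → Set (G → ℂ) := fun x => {w | w x = 0}
  have hZ : ∀ x, IsClosed (Z x) := fun x =>
    isClosed_eq (continuous_apply (x : G)) continuous_const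
  have hK' : IsCompact (K ∩ {w | w a = u a * r}) :=
    hK.inter_right (isClosed_eq (continuous_apply a) continuous_const)
  -- For finite `t`, the complement of `t` is a neighbourhood of `a`; a bump supported there, scaled
  -- by `r` and multiplied by `u`, meets the finitely many constraints.
  obtain ⟨w, ⟨hwK, hwa⟩, hw⟩ := hK'.inter_iInter_nonempty Z hZ fun t => by
    have hW : ((fun y => a * y) ⁻¹' ((↑) '' (t : Set {x : G // x ≠ a}) : Set G)ᶜ) ∈ 𝓝 (1 : G) := by
      refine (continuous_const_mul a).continuousAt.preimage_mem_nhds ?_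
      refine (t.finite_toSet.image _).isClosed.isOpen_compl.mem_nhds ?_
      rintro ⟨x, -, hx⟩
      exact x.2 (by simpa using hx)
    obtain ⟨v, hv, hva, hv0⟩ := exists_Ap_bump μ p q hp hp' a hW
    refine ⟨_, ⟨huK ((r : ℂ) • v) ?_, ?_⟩, Set.mem_iInter₂.mpr fun x hx => ?_⟩
    · rw [norm_smul, Complex.norm_real, Real.norm_of_nonneg hr.le]
      exact mul_le_of_le_one_right hr.le hv
    · simp [hva]
    · have hx0 : Ap.toC0 μ p q v x = 0 := hv0 x (by simpa using ⟨x.2, hx⟩)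
      simp [Z, hx0]
  have hwa' : w a ≠ 0 := by
    rw [hwa]
    exact mul_ne_zero ha (by exact_mod_cast hr.ne')
  have hopen : IsOpen ({a} : Set G) := by
    have hsupp : {a} = w ⁻¹' {0}ᶜ := by
      ext x
      refine ⟨?_, fun hx => ?_⟩
      · rintro rfl
        exact hwa'
      · by_contra hxa
        exact hx (Set.mem_iInter.mp hw ⟨x, hxa⟩)
    rw [hsupp]
    exact isOpen_compl_singleton.preimage (hKc w hwK)
  refine discreteTopology_of_isOpen_singleton_one ?_
  have : ({1} : Set G) = (fun y => a * y) ⁻¹' {a} := by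
    ext x
    simp
  rw [this]
  exact hopen.preimage (continuous_const_mul a)

end HerzAlgebra

theorem lemma4p1 {G : Type*} [Group G] [TopologicalSpace G] [IsTopologicalGroup G]
    [LocallyCompactSpace G] [T2Space G] [MeasurableSpace G] [BorelSpace G]
    (μ : Measure G) [μ.IsHaarMeasure] [μ.Regular]
    (p q : ℝ≥0∞) [p.HolderConjugate q] (hp : 1 < p) (hp' : p < ∞)
    (u : HerzAlgebra.Bp μ p q) (hu : u ≠ 0)
    (h : HerzAlgebra.IsWeaklyCompactOperator (HerzAlgebra.Gam u) ∨
      IsCompactOperator (HerzAlgebra.Gam u)) :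
    DiscreteTopology G := by
  open HerzAlgebra in
  have hu' : ((u : BoundedContinuousFunction G ℂ) : G → ℂ) ≠ 0 := fun h0 =>
    hu (Subtype.ext (DFunLike.coe_injective h0))
  let ev : Ap μ p q → G → ℂ := fun v x => Ap.toC0 μ p q v x
  have hevc : ∀ v, Continuous (ev v) := fun v => (Ap.toC0 μ p q v).continuous
  rcases h with h | h
  -- Continuity from the weak topology lets the whole weak closure be mapped; its limit points are
  -- still elements of `A_p(G)`, hence continuous functions.
  · have hcont : Continuous fun w : WeakSpace ℂ (Ap μ p q) => ev ((toWeakSpace ℂ _).symm w) :=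
      continuous_pi fun x =>
        WeakBilin.eval_continuous (topDualPairing ℂ (Ap μ p q)).flip (evalCLM μ p q x)
    refine discreteTopology_of_isCompact_pointwise μ p q hp hp' hu' (h.image hcont) ?_ one_pos
      fun v hv => ?_
    · rintro _ ⟨w, -, rfl⟩
      exact hevc _
    · refine ⟨toWeakSpace ℂ _ (Gam u v), subset_closure ⟨_, ⟨v, ?_, rfl⟩, rfl⟩, rfl⟩
      simpa using hv
  · obtain ⟨K, hK, hKu⟩ := h
    -- `IsCompactOperator` only provides some neighbourhood of `0` mapped into `K`, hence a radius
    -- `r` in place of `1`.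
    obtain ⟨r, hr, hrK⟩ := Metric.nhds_basis_closedBall.mem_iff.mp hKu
    have hcont : Continuous ev := continuous_pi fun x => (evalCLM μ p q x).continuous
    refine discreteTopology_of_isCompact_pointwise μ p q hp hp' hu' (hK.image hcont) ?_ hr
      fun v hv => ?_
    · rintro _ ⟨w, -, rfl⟩
      exact hevc _
    · exact ⟨Gam u v, hrK (by simpa using hv), rfl⟩
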